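/- All graphs are finite and simple, and an isomorphism of graphs is not distinguished from equality. Let $G_n=\overline{C_n}$ be the graph complement of the cyclic graph $C_n$ (with $C_2=K_2$, $C_1=K_1$, $C_0=\emptyset$), and $G_n^+=\overline{L_n}$ the graph complement of the path graph $L_n$ with $n$ vertices. For a vertex $x$ of a graph $G$, let $S(x)$ be the subgraph induced on the neighbours of $x$, and $G-x$ the graph $G$ with $x$ removed. Contractibility is defined inductively: $K_1$ is contractible, and $G$ is contractible if it has a vertex $x$ such that $S(x)$ and $G-x$ are contractible. Two graphs are homotopic if one is transformed into the other by finitely many steps, each of which removes a vertex $x$ with contractible $S(x)$ (a homotopy reduction) or adds a new vertex joined exactly to the vertices of a contractible induced subgraph (a homotopy extension). For $d\ge 0$ the $d$-sphere is the graph of the cross polytope with $2(d+1)$ vertices, that is, the complement of $d+1$ disjoint copies of $K_2$; the empty graph is the $(-1)$-sphere. Theorem (strict induced subgraphs). Let $n\ge 0$, let $\Gamma$ be $G_n$ or $G_n^+$, and let $W$ be a proper subset of the vertex set of $\Gamma$. Then the subgraph $\Gamma(W)$ of $\Gamma$ induced on $W$ is contractible or homotopic to a $d$-sphere for some $d\ge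 -1$ (with $d\ge 0$ if $W\neq\emptyset$). Moreover there are $k\ge 0$ and integers $\ell_1,\dots,\ell_k\ge 1$ such that $\Gamma(W)$ is isomorphic to the complement $\overline{L_{\ell_1}\sqcup\dots\sqcup L_{\ell_k}}$ of a disjoint union of path graphs (with $L_1=K_1$), and hence isomorphic to the join of the path complements $G_{\ell_1}^+,\dots,G_{\ell_k}^+$, i.e. their disjoint union together with all edges between vertices of different members. -/

import Mathlib

universe u

/-- The graph `G_n`: the complement of the cyclic graph `C_n`
(with `C_2 = K_2`, `C_1 = K_1` and `C_0` the empty graph). -/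
def cycleComplement (n : ℕ) : SimpleGraph (Fin n) := (SimpleGraph.cycleGraph n)ᶜ

/-- The graph `G_n^+`: the complement of the path graph with `n` vertices. -/
def pathComplement (n : ℕ) : SimpleGraph (Fin n) := (SimpleGraph.pathGraph n)ᶜ

/-- The unit sphere `S(x)`: the subgraph induced on the neighbours of `x`. -/
abbrev unitSphere {V : Type u} (G : SimpleGraph V) (x : V) : SimpleGraph (G.neighborSet x) :=
  G.induce (G.neighborSet x)

/-- The graph `G - x` with the vertex `x` removed. -/
abbrev removeVertex {V : Type u} (G : SimpleGraph V) (x : V) :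
    SimpleGraph ({x}ᶜ : Set V) :=
  G.induce ({x}ᶜ : Set V)

/-- Contractible graphs, inductively: a one-vertex graph is contractible, and `G` is contractible
if it has a vertex `x` such that both `S(x)` and `G - x` are contractible. So `G` can be reduced to
a point by successively removing vertices with contractible unit sphere. Every contractible graph
is finite and nonempty. -/
inductive GraphContractible : {V : Type u} → SimpleGraph V → Prop
  | point {V : Type u} (G : SimpleGraph V) (h : Nat.card V = 1) : GraphContractible G
  | step {V : Type u} (G : SimpleGraph V) (x : V)
      (hsphere : GraphContractible (unitSphere G x))
      (hrest : GraphContractible (removeVertex G x)) : GraphContractible G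

/-- Homotopy of graphs: the equivalence relation, on graphs up to isomorphism, generated by the
homotopy reductions (remove a vertex `x` whose unit sphere is contractible) and their reverses, the
homotopy extensions (add a new vertex joined exactly to the vertices of a contractible induced
subgraph). -/
inductive GraphHomotopic : {V W : Type u} → SimpleGraph V → SimpleGraph W → Prop
  | iso {V W : Type u} {G : SimpleGraph V} {H : SimpleGraph W} (e : G ≃g H) : GraphHomotopic G H
  | reduction {V : Type u} (G : SimpleGraph V) (x : V) (h : GraphContractible (unitSphere G x)) :
      GraphHomotopic G (removeVertex G x)
  | symm {V W : Type u} {G : SimpleGraph V} {H : SimpleGraph W} (h : GraphHomotopic G H) :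
      GraphHomotopic H G
  | trans {U V W : Type u} {F : SimpleGraph U} {G : SimpleGraph V} {H : SimpleGraph W}
      (h₁ : GraphHomotopic F G) (h₂ : GraphHomotopic G H) : GraphHomotopic F H

/-- The standard `d`-sphere: the graph of the `(d + 1)`-dimensional cross polytope, with `d + 1`
pairs of antipodal vertices, any two distinct vertices being adjacent unless they are antipodal.
For `d = 0` these are two isolated points, for `d = 1` the 4-cycle, for `d = 2` the octahedron. -/
def sphereGraph (d : ℕ) : SimpleGraph (Fin (d + 1) × Bool) where
  Adj p q := p.1 ≠ q.1
  symm := ⟨fun _ _ h => h.symm⟩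
  loopless := ⟨fun _ h => h rfl⟩

/-- Homotopy spheres: graphs homotopic to the standard `d`-sphere for some `d ≥ 0`, and, as the
sphere of dimension `-1`, the empty graph. -/
def IsHomotopySphere {V : Type} (G : SimpleGraph V) : Prop :=
  IsEmpty V ∨ ∃ d : ℕ, GraphHomotopic G (sphereGraph d)

/-- The disjoint union of a family of graphs. -/
def disjointUnion {ι : Type} {V : ι → Type} (G : ∀ i, SimpleGraph (V i)) :
    SimpleGraph (Σ i, V i) where
  Adj p q := ∃ (i : ι) (a b : V i), (G i).Adj a b ∧ p = ⟨i, a⟩ ∧ q = ⟨i, b⟩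
  symm := ⟨fun _ _ ⟨i, a, b, h, hp, hq⟩ => ⟨i, b, a, h.symm, hq, hp⟩⟩
  loopless := ⟨by
    rintro _ ⟨i, a, b, h, rfl, hq⟩
    cases hq
    exact (G i).irrefl h⟩

/-- The (Zykov) join of a family of graphs: the disjoint union together with all edges between
vertices of different members of the family. -/
def zykovJoin {ι : Type} {V : ι → Type} (G : ∀ i, SimpleGraph (V i)) :
    SimpleGraph (Σ i, V i) where
  Adj p q := p.1 ≠ q.1 ∨ (disjointUnion G).Adj p q
  symm := ⟨fun _ _ h => h.imp Ne.symm fun h' => h'.symm⟩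
  loopless := ⟨fun _ h => h.elim (fun h' => h' rfl) (disjointUnion G).irrefl⟩

/-! Since `W` misses a vertex, the cycle can be cut there, so in either case `Γ(W)` is induced by
the complement of the infinite path on a finite set `S` of naturals
(`exists_iso_natPathComplement_induce`). The maximal runs of `S` are the paths `L_ℓ`, and
complementation turns their disjoint union into a join.

For the homotopy type, look at the least element `v` of `S`. If its run has length 1, `v` is joined
to everything else and the graph is a cone. If it has length 2, the graph is the suspension of the
rest. If it is longer, `S(v + 2)` is a cone with apex `v`, so `v + 2` can be deleted. Induction on
`S` concludes, since suspension preserves contractibility and homotopy spheres. -/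

open SimpleGraph

/-! ### Contractible graphs and cones -/

/-- An isomorphism of graphs restricts to an isomorphism of induced subgraphs. -/
def SimpleGraph.Iso.inducePreimage {V W : Type u} {G : SimpleGraph V} {H : SimpleGraph W}
    (e : G ≃g H) (s : Set V) (t : Set W) (h : ∀ x, x ∈ s ↔ e x ∈ t) :
    G.induce s ≃g H.induce t where
  toEquiv := e.toEquiv.subtypeEquiv h
  map_rel_iff' := e.map_adj_iff

/-- An isomorphism of graphs restricts to an isomorphism of unit spheres. -/
def SimpleGraph.Iso.unitSphere {V W : Type u} {G : SimpleGraph V} {H : SimpleGraph W}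
    (e : G ≃g H) (x : V) : unitSphere G x ≃g unitSphere H (e x) :=
  e.inducePreimage _ _ fun _ => e.map_adj_iff.symm

/-- An isomorphism of graphs restricts to an isomorphism of vertex-deleted subgraphs. -/
def SimpleGraph.Iso.removeVertex {V W : Type u} {G : SimpleGraph V} {H : SimpleGraph W}
    (e : G ≃g H) (x : V) : removeVertex G x ≃g removeVertex H (e x) :=
  e.inducePreimage _ _ fun _ => not_congr e.injective.eq_iff.symm

theorem GraphContractible.of_iso {V W : Type u} {G : SimpleGraph V} {H : SimpleGraph W}
    (hG : GraphContractible G) (e : G ≃g H) : GraphContractible H := by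
  induction hG generalizing W with
  | point G h => exact .point H (by rw [← Nat.card_congr e.toEquiv, h])
  | step G x _ _ ih₁ ih₂ => exact .step H (e x) (ih₁ (e.unitSphere x)) (ih₂ (e.removeVertex x))

/-- A finite graph with a vertex adjacent to all other vertices is contractible. -/
theorem GraphContractible.of_cone {V : Type u} [Finite V] (G : SimpleGraph V) (a : V)
    (ha : ∀ x, x ≠ a → G.Adj a x) : GraphContractible G := by
  induction hn : Nat.card V using Nat.strong_induction_on generalizing V with
  | _ n ih =>
    by_cases hV : ∃ x, x ≠ a
    · obtain ⟨x, hx⟩ := hV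
      -- Any `x ≠ a` can be removed: `a` is still an apex in both `S(x)` and `G - x`.
      refine .step G x ?_ ?_
      · refine ih _ ?_ _ ⟨a, (ha x hx).symm⟩ (fun y hy => ha y fun h => hy (Subtype.ext h)) rfl
        rw [← hn]
        exact Finite.card_subtype_lt (p := (· ∈ G.neighborSet x)) (x := x) (by simp)
      · refine ih _ ?_ _ ⟨a, fun h => hx (Eq.symm h)⟩
          (fun y hy => ha y fun h => hy (Subtype.ext h)) rfl
        rw [← hn]
        exact Finite.card_subtype_lt (p := (· ∈ ({x}ᶜ : Set V))) (x := x) (by simp)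
    · push Not at hV
      exact .point G (Nat.card_eq_one_iff_exists.2 ⟨a, hV⟩)

/-! ### Suspensions -/

/-- The suspension of a graph: two non-adjacent new vertices are joined to all old vertices. -/
def suspension {V : Type u} (G : SimpleGraph V) : SimpleGraph (V ⊕ Bool) where
  Adj
    | .inl x, .inl y => G.Adj x y
    | .inr _, .inr _ => False
    | _, _ => True
  symm := ⟨by rintro (x | x) (y | y) h <;> first | trivial | exact G.adj_symm h⟩
  loopless := ⟨by rintro (x | x) h; exacts [G.irrefl h, h]⟩

section suspension
variable {V W : Type u} {G : SimpleGraph V} {H : SimpleGraph W}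

@[simp] theorem suspension_inl_inl (x y : V) :
    (suspension G).Adj (.inl x) (.inl y) ↔ G.Adj x y := .rfl
@[simp] theorem suspension_inl_inr (x : V) (b : Bool) :
    (suspension G).Adj (.inl x) (.inr b) ↔ True := .rfl
@[simp] theorem suspension_inr_inl (x : V) (b : Bool) :
    (suspension G).Adj (.inr b) (.inl x) ↔ True := .rfl
@[simp] theorem suspension_inr_inr (a b : Bool) :
    (suspension G).Adj (.inr a) (.inr b) ↔ False := .rfl

/-- Suspension is functorial for isomorphisms. -/
def suspensionCongr (e : G ≃g H) : suspension G ≃g suspension H where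
  toEquiv := e.toEquiv.sumCongr (.refl Bool)
  map_rel_iff' := by rintro (x | x) (y | y) <;> simp [e.map_adj_iff]

/-- Suspension commutes with passing to an induced subgraph. -/
def suspensionInduce (G : SimpleGraph V) (s : Set V) (t : Set (V ⊕ Bool))
    (hl : ∀ x, .inl x ∈ t ↔ x ∈ s) (hr : ∀ b, .inr b ∈ t) :
    (suspension G).induce t ≃g suspension (G.induce s) where
  toFun
    | ⟨.inl x, h⟩ => .inl ⟨x, (hl x).1 h⟩
    | ⟨.inr b, _⟩ => .inr b
  invFun
    | .inl x => ⟨.inl x, (hl x).2 x.2⟩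
    | .inr b => ⟨.inr b, hr b⟩
  left_inv := by rintro ⟨x | x, h⟩ <;> rfl
  right_inv := by rintro (x | x) <;> rfl
  map_rel_iff' := by rintro ⟨x | x, h⟩ ⟨y | y, h'⟩ <;> simp

/-- The unit sphere of the suspension at an old vertex. -/
def unitSphereSuspension (G : SimpleGraph V) (x : V) :
    unitSphere (suspension G) (.inl x) ≃g suspension (unitSphere G x) :=
  suspensionInduce G _ _ (fun _ => .rfl) fun _ => trivial

/-- Removing an old vertex from the suspension. -/
def removeVertexSuspension (G : SimpleGraph V) (x : V) :
    removeVertex (suspension G) (.inl x) ≃g suspension (removeVertex G x) :=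
  suspensionInduce G _ _ (fun _ => by simp) fun _ => by simp

/-- The same order of vertex removals works, as spheres and deletions at old vertices commute with
suspension. It ends at the suspension of a point, a cone over the two new vertices. -/
theorem GraphContractible.suspension (hG : GraphContractible G) :
    GraphContractible (suspension G) := by
  induction hG with
  | @point V G h =>
    obtain ⟨a, ha⟩ := Nat.card_eq_one_iff_exists.1 h
    have : Finite V := Nat.finite_of_card_ne_zero (by omega)
    refine .of_cone _ (.inl a) ?_
    rintro (x | b) hx
    · exact absurd (congrArg _ (ha x)) hx
    · trivial
  | step G x _ _ ih₁ ih₂ =>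
    exact .step _ (.inl x) (ih₁.of_iso (unitSphereSuspension G x).symm)
      (ih₂.of_iso (removeVertexSuspension G x).symm)

theorem GraphHomotopic.suspension (h : GraphHomotopic G H) :
    GraphHomotopic (suspension G) (suspension H) := by
  induction h with
  | iso e => exact .iso (suspensionCongr e)
  | reduction G x h =>
    exact .trans (.reduction _ (.inl x) (h.suspension.of_iso (unitSphereSuspension G x).symm))
      (.iso (removeVertexSuspension G x))
  | symm _ ih => exact .symm ih
  | trans _ _ ih₁ ih₂ => exact .trans ih₁ ih₂

end suspension

/-- The suspension of the empty graph is the `0`-sphere. -/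
def suspensionEmpty {V : Type} [IsEmpty V] (G : SimpleGraph V) :
    suspension G ≃g sphereGraph 0 where
  toEquiv := (Equiv.emptySum V Bool).trans (Equiv.uniqueProd Bool (Fin 1)).symm
  map_rel_iff' := by
    rintro (x | x) (y | y)
    · exact isEmptyElim x
    · exact isEmptyElim x
    · exact isEmptyElim y
    · simp [sphereGraph]

/-- The suspension of the `d`-sphere is the `(d + 1)`-sphere. -/
def suspensionSphere (d : ℕ) : suspension (sphereGraph d) ≃g sphereGraph (d + 1) where
  toFun
    | .inl p => (p.1.castSucc, p.2)
    | .inr b => (Fin.last _, b)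
  invFun p := Fin.lastCases (motive := fun _ => Fin (d + 1) × Bool ⊕ Bool)
    (.inr p.2) (fun i => .inl (i, p.2)) p.1
  left_inv := by rintro (x | x) <;> simp
  right_inv := by
    rintro ⟨i, b⟩
    induction i using Fin.lastCases <;> simp
  map_rel_iff' := by
    rintro (x | x) (y | y) <;>
      simp [sphereGraph, Fin.castSucc_ne_last, (Fin.castSucc_ne_last _).symm]

/-- Cross polytopes are iterated suspensions of the empty graph, so the dimension rises by one. -/
theorem IsHomotopySphere.suspension {V : Type} {G : SimpleGraph V} (h : IsHomotopySphere G) :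
    IsHomotopySphere (suspension G) := by
  rcases h with h | ⟨d, h⟩
  · exact .inr ⟨0, .iso (suspensionEmpty G)⟩
  · exact .inr ⟨d + 1, h.suspension.trans (.iso (suspensionSphere d))⟩

theorem IsHomotopySphere.of_iso {V W : Type} {G : SimpleGraph V} {H : SimpleGraph W}
    (h : IsHomotopySphere G) (e : G ≃g H) : IsHomotopySphere H := by
  rcases h with h | ⟨d, h⟩
  · exact .inl e.symm.toEquiv.isEmpty
  · exact .inr ⟨d, .trans (.iso e.symm) h⟩

/-! ### Induced subgraphs of induced subgraphs -/

/-- An induced subgraph of an induced subgraph is an induced subgraph. -/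
def induceInduce {V : Type u} (G : SimpleGraph V) (s : Set V) (t : Set s) (r : Set V)
    (h : ∀ x, x ∈ r ↔ ∃ hx : x ∈ s, ⟨x, hx⟩ ∈ t) : (G.induce s).induce t ≃g G.induce r where
  toFun x := ⟨x, (h x).2 ⟨x.1.2, x.2⟩⟩
  invFun x := ⟨⟨x, ((h x).1 x.2).1⟩, ((h x).1 x.2).2⟩
  left_inv _ := rfl
  right_inv _ := rfl
  map_rel_iff' := .rfl

/-! ### Complements of linear forests -/

/-- The complement of the infinite path on the natural numbers: its finite induced subgraphs are
the complements of linear forests. -/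
def natPathComplement : SimpleGraph ℕ := (hasse ℕ)ᶜ

theorem natPathComplement_adj {a b : ℕ} :
    natPathComplement.Adj a b ↔ a ≠ b ∧ a + 1 ≠ b ∧ b + 1 ≠ a := by
  simp [natPathComplement, hasse_adj, Nat.covBy_iff_add_one_eq]

theorem natPathComplement_induce_contractible_or_sphere (S : Finset ℕ) :
    GraphContractible (natPathComplement.induce (S : Set ℕ)) ∨
      IsHomotopySphere (natPathComplement.induce (S : Set ℕ)) := by
  induction S using Finset.strongInduction with
  | _ S ih =>
  rcases S.eq_empty_or_nonempty with rfl | hS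
  · exact .inr (.inl (by simp))
  set v := S.min' hS
  have hvS : v ∈ S := S.min'_mem hS
  have hmin : ∀ x ∈ S, v ≤ x := S.min'_le
  by_cases h1 : v + 1 ∈ S
  · by_cases h2 : v + 2 ∈ S
    · let x : (S : Set ℕ) := ⟨v + 2, h2⟩
      have hc : GraphContractible (unitSphere (natPathComplement.induce (S : Set ℕ)) x) := by
        -- The only other vertex not adjacent to `v` is `v + 1`, which is not in `S(v + 2)`.
        refine .of_cone _ ⟨⟨v, hvS⟩, natPathComplement_adj.2 (by dsimp [x]; omega)⟩ ?_
        rintro ⟨⟨y, hyS⟩, hy⟩ hne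
        have hy' := natPathComplement_adj.1 hy
        have hne' : y ≠ v := fun h => hne (Subtype.ext (Subtype.ext h))
        have := hmin y hyS
        refine natPathComplement_adj.2 ?_
        simp only [x] at hy' ⊢
        dsimp at hy' ⊢
        omega
      have e : removeVertex (natPathComplement.induce (S : Set ℕ)) x ≃g
          natPathComplement.induce (S.erase (v + 2) : Set ℕ) :=
        induceInduce _ _ _ _ fun y => by simp [x, Subtype.ext_iff]
      rcases ih _ (Finset.erase_ssubset h2) with h | h
      · exact .inl (.step _ x hc (h.of_iso e.symm))
      · rcases h.of_iso e.symm with h | ⟨d, h⟩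
        -- The sphere of dimension `-1` cannot occur, because `v` survives the deletion.
        · exact (h.false ⟨⟨v, hvS⟩, by simp [x]⟩).elim
        · exact .inr (.inr ⟨d, .trans (.reduction _ x hc) h⟩)
    · set T := (S.erase (v + 1)).erase v with hT
      have hTS : T ⊂ S :=
        (Finset.erase_subset _ _).trans_ssubset (Finset.erase_ssubset h1)
      -- The gap at `v + 2` makes every remaining vertex adjacent to both `v` and `v + 1`, the two
      -- suspension points.
      have hTv : ∀ x ∈ T, v + 2 < x := fun x hx => by
        simp only [hT, Finset.mem_erase] at hx
        have := hmin x hx.2.2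
        have : x ≠ v + 2 := fun h => h2 (h ▸ hx.2.2)
        omega
      have e : suspension (natPathComplement.induce (T : Set ℕ)) ≃g
          natPathComplement.induce (S : Set ℕ) :=
        { toEquiv := Equiv.ofBijective
            (Sum.elim (fun x => ⟨x, hTS.1 x.2⟩)
              (fun b => if b then ⟨v, hvS⟩ else ⟨v + 1, h1⟩)) (by
            constructor
            · rintro (⟨x, hx⟩ | x) (⟨y, hy⟩ | y) h
              · simpa using h
              · have := hTv x hx
                cases y <;> simp at h <;> omega
              · have := hTv y hy
                cases x <;> simp at h <;> omega
              · cases x <;> cases y <;> simp at h ⊢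
            · rintro ⟨y, hy⟩
              by_cases h0 : y = v
              · exact ⟨.inr true, by simp [h0]⟩
              · by_cases h0' : y = v + 1
                · exact ⟨.inr false, by simp [h0']⟩
                · exact ⟨.inl ⟨y, by simpa [hT, h0, h0'] using hy⟩, rfl⟩)
          map_rel_iff' := by
            rintro (⟨x, hx⟩ | x) (⟨y, hy⟩ | y)
            · simp
            · have := hTv x hx
              cases y <;> simp [natPathComplement_adj] <;> omega
            · have := hTv y hy
              cases x <;> simp [natPathComplement_adj] <;> omega
            · cases x <;> cases y <;> simp [natPathComplement_adj] }
      rcases ih T hTS with h | h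
      · exact .inl (h.suspension.of_iso e)
      · exact .inr (h.suspension.of_iso e)
  · refine .inl (.of_cone _ ⟨v, hvS⟩ ?_)
    rintro ⟨y, hyS⟩ hne
    have hne' : y ≠ v := fun h => hne (Subtype.ext h)
    have hne'' : y ≠ v + 1 := fun h => h1 (h ▸ hyS)
    have := hmin y hyS
    refine natPathComplement_adj.2 ?_
    dsimp
    omega

/-- A finite set of natural numbers decomposes into maximal runs of consecutive numbers. -/
theorem natPathComplement_induce_iso_disjointUnion (S : Finset ℕ) :
    ∃ (k : ℕ) (ℓ : Fin k → ℕ), (∀ i, 1 ≤ ℓ i) ∧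
      Nonempty (natPathComplement.induce (S : Set ℕ) ≃g
        (disjointUnion fun i => pathGraph (ℓ i))ᶜ) := by
  classical
  let starts := S.filter fun s => ∀ t ∈ S, t + 1 ≠ s
  have hend : ∀ s, ∃ j, s + j ∉ S := fun s => by
    obtain ⟨b, hb⟩ := S.bddAbove
    exact ⟨b + 1, fun h => by have := hb h; omega⟩
  let len : ℕ → ℕ := fun s => Nat.find (hend s)
  have hlen : ∀ s, s + len s ∉ S := fun s => Nat.find_spec (hend s)
  have hrun : ∀ s j, j < len s → s + j ∈ S := fun s j h => not_not.1 (Nat.find_min (hend s) h)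
  have hne : ∀ s ∈ S, 1 ≤ len s := fun s hs => Nat.one_le_iff_ne_zero.2 fun h => by
    have := hlen s
    rw [h] at this
    exact this hs
  have hcover : ∀ x, x ∈ S → ∃ s ∈ starts, ∃ j < len s, s + j = x := by
    intro x
    induction x with
    | zero => exact fun hx => ⟨0, by simp [starts, hx], 0, hne 0 hx, rfl⟩
    | succ x ih =>
      intro hx
      by_cases hxS : x ∈ S
      · obtain ⟨s, hs, j, hj, rfl⟩ := ih hxS
        refine ⟨s, hs, j + 1, lt_of_le_of_ne hj fun h => hlen s ?_, rfl⟩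
        rwa [← h]
      · refine ⟨x + 1, ?_, 0, hne _ hx, rfl⟩
        simp only [starts, Finset.mem_filter]
        exact ⟨hx, fun t ht h => hxS (by rwa [← Nat.succ_injective h])⟩
  -- Elements at distance at most 1 lie in the same run: otherwise the predecessor of the later
  -- start would lie in the other run. Distance 0 gives injectivity of `g`, distance 1 the
  -- adjacency.
  have hsep : ∀ s ∈ starts, ∀ s' ∈ starts, ∀ j < len s, ∀ j' < len s',
      s + j ≤ s' + j' → s' + j' ≤ s + j + 1 → s = s' := by
    intro s hs s' hs' j hj j' hj' h₁ h₂
    rcases lt_trichotomy s s' with h | h | h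
    · refine absurd ?_ ((Finset.mem_filter.1 hs').2 (s + (s' - 1 - s)) (hrun _ _ (by omega)))
      omega
    · exact h
    · refine absurd ?_ ((Finset.mem_filter.1 hs).2 (s' + (s - 1 - s')) (hrun _ _ (by omega)))
      omega
  let f := starts.equivFin.symm
  let g : (Σ i : Fin starts.card, Fin (len (f i))) → (S : Set ℕ) :=
    fun p => ⟨f p.1 + p.2, hrun _ _ p.2.2⟩
  have hsep' : ∀ p q, (g p : ℕ) ≤ g q → (g q : ℕ) ≤ g p + 1 → p.1 = q.1 := fun p q h₁ h₂ =>
    f.injective (Subtype.ext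
      (hsep _ (f p.1).2 _ (f q.1).2 _ p.2.2 _ q.2.2 h₁ h₂))
  have hg : Function.Bijective g := by
    constructor
    · intro p q h
      have h' : (g p : ℕ) = g q := congrArg _ h
      have := hsep' p q h'.le (by omega)
      obtain ⟨i, a⟩ := p
      obtain ⟨j, b⟩ := q
      obtain rfl : i = j := this
      have : a = b := Fin.ext (by simpa [g] using h')
      rw [this]
    · rintro ⟨x, hx⟩
      obtain ⟨s, hs, j, hj, rfl⟩ := hcover x hx
      exact ⟨⟨f.symm ⟨s, hs⟩, j, by simpa using hj⟩, by simp [g]⟩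
  have hadj : ∀ p q, (disjointUnion fun i => pathGraph (len (f i))).Adj p q ↔
      (g p : ℕ) + 1 = g q ∨ (g q : ℕ) + 1 = g p := by
    intro p q
    constructor
    · rintro ⟨i, a, b, h, rfl, rfl⟩
      rw [pathGraph_adj] at h
      simp only [g]
      omega
    · intro h
      have hpq : p.1 = q.1 := by
        rcases h with h | h
        · exact hsep' p q (by omega) (by omega)
        · exact (hsep' q p (by omega) (by omega)).symm
      obtain ⟨i, a⟩ := p
      obtain ⟨j, b⟩ := q
      obtain rfl : i = j := hpq
      refine ⟨i, a, b, pathGraph_adj.2 ?_, rfl, rfl⟩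
      simp only [g] at h
      omega
  refine ⟨starts.card, fun i => len (f i), fun i => hne _ (Finset.mem_filter.1 (f i).2).1, ⟨?_⟩⟩
  refine RelIso.symm ⟨Equiv.ofBijective g hg, ?_⟩
  intro p q
  rw [compl_adj, hadj]
  simp only [Equiv.ofBijective_apply, comap_adj, Function.Embedding.subtype_apply,
    natPathComplement_adj, not_or]
  rw [← hg.1.ne_iff, ne_eq (g p), Subtype.ext_iff]

/-- The complement of a disjoint union is the join of the complements. -/
def complDisjointUnionIso {ι : Type} {V : ι → Type} (G : ∀ i, SimpleGraph (V i)) :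
    (disjointUnion G)ᶜ ≃g zykovJoin fun i => (G i)ᶜ where
  toEquiv := .refl _
  map_rel_iff' := by
    rintro ⟨i, a⟩ ⟨j, b⟩
    by_cases hij : i = j
    · subst hij
      have key : ∀ H : ∀ i, SimpleGraph (V i),
          (disjointUnion H).Adj ⟨i, a⟩ ⟨i, b⟩ ↔ (H i).Adj a b := by
        intro H
        constructor
        · rintro ⟨_, _, _, h, h₁, h₂⟩
          cases h₁
          cases h₂
          exact h
        · exact fun h => ⟨i, a, b, h, rfl, rfl⟩
      simp [zykovJoin, key, compl_adj]
    · have key : ¬ (disjointUnion G).Adj ⟨i, a⟩ ⟨j, b⟩ := by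
        rintro ⟨_, _, _, _, h₁, h₂⟩
        cases h₁
        cases h₂
        exact hij rfl
      simp [zykovJoin, key, compl_adj, hij]

/-! ### Cutting the cycle at a missing vertex -/

/-- A proper induced subgraph of the complement of a cycle or a path is the complement of a linear
forest. -/
theorem exists_iso_natPathComplement_induce (n : ℕ) (Γ : SimpleGraph (Fin n))
    (hΓ : Γ = cycleComplement n ∨ Γ = pathComplement n)
    (W : Set (Fin n)) (hW : W ≠ Set.univ) :
    ∃ S : Finset ℕ, Nonempty (Γ.induce W ≃g natPathComplement.induce (S : Set ℕ)) := by
  classical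
  suffices h : ∃ f : Fin n → ℕ, Function.Injective f ∧
      ∀ x ∈ W, ∀ y ∈ W, Γ.Adj x y ↔ natPathComplement.Adj (f x) (f y) by
    obtain ⟨f, hf, hadj⟩ := h
    refine ⟨W.toFinset.image f, ⟨⟨(Equiv.Set.image f W hf).trans (Equiv.setCongr (by simp)), ?_⟩⟩⟩
    rintro ⟨x, hx⟩ ⟨y, hy⟩
    exact (hadj x hx y hy).symm
  rcases hΓ with rfl | rfl
  · obtain ⟨m, hm⟩ := (Set.ne_univ_iff_exists_notMem W).1 hW
    have : NeZero n := ⟨by have := m.2; omega⟩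
    -- Rotating `m ∉ W` to `0` puts `W` into `1, …, n - 1`, where no edge of the cycle wraps around.
    refine ⟨fun x => (x - m : Fin n), fun x y h => sub_left_injective (Fin.ext h), ?_⟩
    intro x hx y hy
    have hx' : x - m ≠ 0 := fun h => hm (sub_eq_zero.1 h ▸ hx)
    have hy' : y - m ≠ 0 := fun h => hm (sub_eq_zero.1 h ▸ hy)
    rw [cycleComplement, compl_adj, cycleGraph_adj', natPathComplement_adj]
    have e₁ : x - y = (x - m) - (y - m) := by abel
    have e₂ : y - x = (y - m) - (x - m) := by abel
    have e₃ : x = y ↔ x - m = y - m := sub_left_inj.symm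
    rw [e₁, e₂, ne_eq, e₃]
    beta_reduce
    generalize x - m = a at *
    generalize y - m = b at *
    have ha : (a : ℕ) ≠ 0 := fun h => hx' (Fin.ext h)
    have hb : (b : ℕ) ≠ 0 := fun h => hy' (Fin.ext h)
    have := a.2
    have := b.2
    rw [Fin.ext_iff]
    rcases lt_trichotomy a b with h | rfl | h
    · rw [Fin.coe_sub_iff_lt.2 h, Fin.coe_sub_iff_le.2 h.le]
      have := Fin.lt_def.1 h
      omega
    · simp
    · rw [Fin.coe_sub_iff_lt.2 h, Fin.coe_sub_iff_le.2 h.le]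
      have := Fin.lt_def.1 h
      omega
  · refine ⟨Fin.val, Fin.val_injective, fun x _ y _ => ?_⟩
    rw [pathComplement, compl_adj, pathGraph_adj, natPathComplement_adj, not_or, ne_eq, Fin.ext_iff]

theorem mainTheorem8 (n : ℕ) (Γ : SimpleGraph (Fin n))
    (hΓ : Γ = cycleComplement n ∨ Γ = pathComplement n)
    (W : Set (Fin n)) (hW : W ≠ Set.univ) :
    (GraphContractible (Γ.induce W) ∨ IsHomotopySphere (Γ.induce W)) ∧
    ∃ (k : ℕ) (ℓ : Fin k → ℕ), (∀ i, 1 ≤ ℓ i) ∧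
      Nonempty (Γ.induce W ≃g (disjointUnion fun i => SimpleGraph.pathGraph (ℓ i))ᶜ) ∧
      Nonempty (Γ.induce W ≃g zykovJoin fun i => pathComplement (ℓ i)) := by
  obtain ⟨S, ⟨e⟩⟩ := exists_iso_natPathComplement_induce n Γ hΓ W hW
  refine ⟨(natPathComplement_induce_contractible_or_sphere S).imp
    (fun h => h.of_iso e.symm) (fun h => h.of_iso e.symm), ?_⟩
  obtain ⟨k, ℓ, hℓ, ⟨e'⟩⟩ := natPathComplement_induce_iso_disjointUnion S
  exact ⟨k, ℓ, hℓ, ⟨e'.comp e⟩, ⟨(complDisjointUnionIso _).comp (e'.comp e)⟩⟩
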